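/- Let $c>b>a\ge 2$ be pairwise coprime integers, and let $g(a,b,c)$ be the Frobenius number, i.e. the largest positive integer that is not of the form $an_1+bn_2+cn_3$ with integers $n_1,n_2,n_3\ge 0$. For an integer $z$ and $n\ge 1$, let $z \bmod n$ denote the representative of $z$ in $\{0,1,\ldots,n-1\}$. Put $$k=\left\lfloor \tfrac{c}{b}\right\rfloor,\quad \ell = cb^{-1} \bmod a,\quad q=\left\lfloor\tfrac{a}{a-\ell}\right\rfloor,\quad r=a-q(a-\ell),$$ and assume $\ell>k$ and $br>cq$. Let $u=(a-\ell)\bmod r$, $A=br-cq$, $B=b(a-\ell-r)+c(q+1)$, $$\Lambda=\left\lfloor\tfrac{r}{a-\ell-r}\right\rfloor,\quad \Delta=\left\lfloor\tfrac{A}{B}\right\rfloor,\quad \Lambda'=\left\lfloor\tfrac{a-\ell-r}{r}\right\rfloor,\quad \Delta'=\left\lfloor\tfrac{B}{A}\right\rfloor,$$ $$\mu=\min\left\{i\in\mathbb{Z}_{\ge 0} : \left\lfloor\tfrac{(i+1)B}{A}\right\rfloor\ne\left\lfloor\tfrac{(i+1)(a-\ell-r)}{r}\right\rfloor\right\}.$$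 (Under these assumptions all the denominators, as well as $u$, are positive.) For an integer $x$, let $\mathbf m(x)$ be the least positive integer congruent to $x$ modulo $a$ of the form $bn_1+cn_2$ with integers $n_1,n_2\ge 0$, and let $$\mathscr X=\{x\in\{1,\ldots,r\} : \mathbf m(bx)\equiv 0 \bmod c\}.$$ For integers $i\ge 0$ put $$x_i=r\left(\left\lfloor\tfrac{(a-\ell-r)i}{r}\right\rfloor+1\right)-(a-\ell-r)i,\qquad y_i=q\left(\left\lfloor\tfrac{(a-\ell-r)i}{r}\right\rfloor+1\right)+(q+1)i.$$ Then the following hold. (a) If $\mu<\lfloor \tfrac ru\rfloor$, then $$g(a,b,c)+a=\max\left\{b(r-\mu u-1),\ b(u-1)+c\left(\mu(q+1)+\left(\left\lfloor\tfrac{(a-\ell-r)\mu}{r}\right\rfloor+1\right)q\right)\right\}+cq\left\lfloor\tfrac{a-\ell-1}{r}\right\rfloor.$$ Furthermore, if $\Lambda>\Delta$, then $$g(a,b,c)+a=\max\left\{b(r-\Delta(a-\ell-r)-1),\ b(a-\ell-r-1)+c\left(\Delta(q+1)+q\right)\right\}+cq,$$ and if $\Delta'>\Lambda'$, then $$g(a,b,c)+a=\max\left\{b(r-1),\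 b\left((a-\ell-1)\bmod r\right)+cq\right\}+cq\left\lfloor\tfrac{a-\ell-1}{r}\right\rfloor.$$ (b) If $\mu>\lfloor \tfrac ru\rfloor$, then $\mathscr X=\{x_i : 0\le i\le\mu\}$; there are $m\in\{0,\ldots,\mu\}$ with $x_m=\min\mathscr X$ and a largest $w\in\{0,\ldots,\mu\}$ with $x_w+x_m\in\mathscr X$; and for any such $m$ and $w$ one has $m\ge 1$ and $$g(a,b,c)+a=\max\left\{b(x_m-1)+cy_w,\ b(x_{m-1}-x_\mu-1)+cy_\mu\right\}+cq\left\lfloor\tfrac{a-\ell-1}{r}\right\rfloor.$$ -/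

import Mathlib

namespace Frob3

/-- The representative in `{0, …, a - 1}` of `c * b⁻¹` modulo `a` (used for `b` coprime to `a`). -/
def ell (a b c : ℕ) : ℕ := ((c : ZMod a) * (b : ZMod a)⁻¹).val

/-- The least positive integer that is congruent to `x` modulo `a` and has the form `b n₁ + c n₂`
with non-negative integers `n₁, n₂`. -/
noncomputable def minRep (a b c : ℕ) (x : ℤ) : ℕ :=
  sInf {z : ℕ | 0 < z ∧ (∃ n₁ n₂ : ℕ, z = b * n₁ + c * n₂) ∧ (z : ℤ) ≡ x [ZMOD a]}

/-- The set of all `x ∈ {1, …, r}` for which the least element in the class of `b x` modulo `a`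
is divisible by `c`. -/
def setX (a b c : ℕ) (r : ℤ) : Set ℤ :=
  {x : ℤ | 1 ≤ x ∧ x ≤ r ∧ (minRep a b c (b * x) : ℤ) ≡ 0 [ZMOD c]}

/-- The indices `i ≥ 0` with `⌊(i + 1) B / A⌋ ≠ ⌊(i + 1) e / r⌋`. (Division on `ℤ` by a positive
integer is the floor of the quotient.) -/
def muSet (A B e r : ℤ) : Set ℕ :=
  {i : ℕ | ((i : ℤ) + 1) * B / A ≠ ((i : ℤ) + 1) * e / r}

/-- The least element of `muSet`. -/
noncomputable def mu (A B e r : ℤ) : ℕ := sInf (muSet A B e r)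

/-- If `e / r < B / A`, then `muSet` is non-empty, so that `mu` is a genuine minimum. With
`A = b r - c q > 0` and `B = b e + c (q + 1)` one has `B r - A e = c ((q + 1) r + q e) > 0`. -/
theorem muSet_nonempty {A B e r : ℤ} (hA : 0 < A) (hr : 0 < r) (h : A * e < B * r) :
    (muSet A B e r).Nonempty := by
  have hAr : 0 < A * r := mul_pos hA hr
  refine ⟨(A * r - 1).toNat, ?_⟩
  have hc : (((A * r - 1).toNat : ℕ) : ℤ) + 1 = A * r := by
    rw [Int.toNat_of_nonneg (by linarith)]; ring
  simp only [muSet, Set.mem_ofPred_eq, hc]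
  rw [show A * r * B = A * (B * r) by ring, show A * r * e = r * (A * e) by ring,
    Int.mul_ediv_cancel_left _ hA.ne', Int.mul_ediv_cancel_left _ hr.ne']
  exact h.ne'

end Frob3

/-! ### L-shapes and the Frobenius number -/

namespace Frob3

/-! By the Brauer–Shockley principle, g + a is the maximum, over the residue classes modulo a, of
the least element b i + c j (i, j ≥ 0) of the class. These minima are the weights of the points of
an L-shape, a fundamental domain for the lattice of (X, Y) with a ∣ bX + cY, so the maximum sits at
one of its two outer corners (`LShape.frobeniusNumber`).

The L-shape comes from the lattice vectors (x_i, -y_i), i ≥ 0: these are all those with 0 < x ≤ r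
and y ≥ 0, sorted by y (`exists_index`). By `firstNeg_mu`, N = μ + 1 is the first index of negative
weight. If x_m is minimal among x_0, …, x_μ, then (x_m, -y_m) and (-x_N, y_N) span the L-shape
(`LatticeBasis.lShape`). As (x_N, y_N) = (x_μ - u, y_μ + h), the corners are explicit. In (a), x_i
decreases up to μ, so m = μ. In (b), `mem_setX` identifies 𝒳 with the x_i for i ≤ μ, and w = μ - m.
-/

theorem mem_closure_triple {a b c n : ℕ} :
    n ∈ AddSubmonoid.closure ({a, b, c} : Set ℕ) ↔
      ∃ i j k : ℕ, n = a * i + b * j + c * k := by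
  constructor
  · intro hn
    induction hn using AddSubmonoid.closure_induction with
    | mem x hx =>
      rcases hx with rfl | rfl | rfl
      · exact ⟨1, 0, 0, by ring⟩
      · exact ⟨0, 1, 0, by ring⟩
      · exact ⟨0, 0, 1, by ring⟩
    | zero => exact ⟨0, 0, 0, by ring⟩
    | add x y _ _ hx hy =>
      obtain ⟨i, j, k, rfl⟩ := hx
      obtain ⟨i', j', k', rfl⟩ := hy
      exact ⟨i + i', j + j', k + k', by ring⟩
  · rintro ⟨i, j, k, rfl⟩
    have key : ∀ {z : ℕ} (t : ℕ), z ∈ ({a, b, c} : Set ℕ) →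
        z * t ∈ AddSubmonoid.closure ({a, b, c} : Set ℕ) := fun {z} t hz => by
      rw [mul_comm, ← smul_eq_mul]
      exact AddSubmonoid.nsmul_mem _ (AddSubmonoid.subset_closure hz) t
    exact add_mem (add_mem (key i (by simp)) (key j (by simp))) (key k (by simp))

/-- An L-shape: the points `(i, j)` of the quadrant that are not above any of `(p₁, 0)`, `(0, q₂)`
and `(p₁ - q₁, q₂ - p₂)`, for two vectors `(p₁, -p₂)` and `(-q₁, q₂)` of positive weight in the
lattice of all `(X, Y)` with `a ∣ b X + c Y`, such that two different points of the L-shape are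
never congruent modulo the lattice. -/
structure LShape (a b c p₁ p₂ q₁ q₂ : ℤ) : Prop where
  q₁_nonneg : 0 ≤ q₁
  q₁_lt : q₁ < p₁
  p₂_nonneg : 0 ≤ p₂
  p₂_lt : p₂ < q₂
  dvd_p : a ∣ b * p₁ - c * p₂
  dvd_q : a ∣ c * q₂ - b * q₁
  pos_p : c * p₂ < b * p₁
  pos_q : b * q₁ < c * q₂
  sep_neg : ∀ X Y : ℤ, a ∣ b * X + c * Y → 0 ≤ X → X < p₁ → Y ≤ 0 → -Y < q₂ → X = 0 ∧ Y = 0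
  sep_pos : ∀ X Y : ℤ, a ∣ b * X + c * Y → 0 < X → X < p₁ → 0 < Y → Y < q₂ →
    p₁ - q₁ ≤ X ∧ q₂ - p₂ ≤ Y

/-- The points of an L-shape. -/
def InL (p₁ p₂ q₁ q₂ i j : ℤ) : Prop :=
  0 ≤ i ∧ 0 ≤ j ∧ i < p₁ ∧ j < q₂ ∧ (i < p₁ - q₁ ∨ j < q₂ - p₂)

namespace LShape

variable {a b c p₁ p₂ q₁ q₂ : ℤ}

/-- Descent on the weight: a point outside the L-shape stays in the quadrant after subtracting (p₁,
-p₂), (-q₁, q₂) or their sum, each of positive weight. -/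
theorem exists_reduction (H : LShape a b c p₁ p₂ q₁ q₂) (hb : 0 < b) (hc : 0 < c) :
    ∀ (n : ℕ) (i j : ℤ), 0 ≤ i → 0 ≤ j → b * i + c * j ≤ n →
      ∃ i' j' : ℤ, InL p₁ p₂ q₁ q₂ i' j' ∧ b * i' + c * j' ≤ b * i + c * j ∧
        a ∣ b * (i - i') + c * (j - j') := by
  intro n
  induction n using Nat.strong_induction_on with
  | _ n ih =>
  intro i j hi hj hn
  obtain ⟨h1, h2, h3, h4, h5, h6, h7, h8, -, -⟩ := H
  have step : ∀ X Y : ℤ, 0 ≤ i - X → 0 ≤ j - Y → 0 < b * X + c * Y → a ∣ b * X + c * Y →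
      ∃ i' j' : ℤ, InL p₁ p₂ q₁ q₂ i' j' ∧ b * i' + c * j' ≤ b * i + c * j ∧
        a ∣ b * (i - i') + c * (j - j') := by
    intro X Y hX hY hpos hdvd
    have e0 : 0 ≤ b * (i - X) + c * (j - Y) := by positivity
    have e1 : b * (i - X) + c * (j - Y) < n := by linarith
    obtain ⟨i', j', hin, hle, hd⟩ := ih (b * (i - X) + c * (j - Y)).toNat (by omega)
      (i - X) (j - Y) hX hY (by omega)
    refine ⟨i', j', hin, by linarith, ?_⟩
    have := dvd_add hd hdvd
    exact this.trans (dvd_of_eq (by ring))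
  by_cases c1 : p₁ ≤ i
  · refine step p₁ (-p₂) (by omega) (by omega) (by linarith) ?_
    exact h5.trans (dvd_of_eq (by ring))
  by_cases c2 : q₂ ≤ j
  · refine step (-q₁) q₂ (by omega) (by omega) (by linarith) ?_
    exact h6.trans (dvd_of_eq (by ring))
  by_cases c3 : p₁ - q₁ ≤ i ∧ q₂ - p₂ ≤ j
  · refine step (p₁ - q₁) (q₂ - p₂) (by omega) (by omega) (by linarith) ?_
    exact (dvd_add h5 h6).trans (dvd_of_eq (by ring))
  · exact ⟨i, j, ⟨hi, hj, by omega, by omega, by omega⟩, le_rfl, by simp⟩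

theorem eq_of_dvd (H : LShape a b c p₁ p₂ q₁ q₂) {i j i' j' : ℤ} (h : InL p₁ p₂ q₁ q₂ i j)
    (h' : InL p₁ p₂ q₁ q₂ i' j') (hd : a ∣ b * (i - i') + c * (j - j')) : i = i' ∧ j = j' := by
  have main : ∀ {i j i' j' : ℤ}, InL p₁ p₂ q₁ q₂ i j → InL p₁ p₂ q₁ q₂ i' j' →
      a ∣ b * (i - i') + c * (j - j') → i' ≤ i → i = i' ∧ j = j' := by
    intro i j i' j' h h' hd hle
    obtain ⟨h1, h2, h3, h4, h5⟩ := h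
    obtain ⟨k1, k2, k3, k4, k5⟩ := h'
    have hp := H.p₂_nonneg
    have hq := H.q₁_nonneg
    rcases le_or_gt (j - j') 0 with hj | hj
    · have := H.sep_neg _ _ hd (by omega) (by omega) hj (by omega)
      omega
    · rcases eq_or_lt_of_le hle with he | hlt
      · have := H.sep_neg (i - i') (j' - j) (by
          rw [he]; rw [he] at hd
          have := (dvd_neg (α := ℤ)).2 hd
          exact this.trans (dvd_of_eq (by ring))) (by omega) (by omega) (by omega) (by omega)
        omega
      · have := H.sep_pos _ _ hd (by omega) (by omega) hj (by omega)
        omega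
  rcases le_total i' i with hle | hle
  · exact main h h' hd hle
  · have := main h' h (by
      have := (dvd_neg (α := ℤ)).2 hd
      exact this.trans (dvd_of_eq (by ring))) hle
    exact ⟨this.1.symm, this.2.symm⟩

theorem le_of_dvd (H : LShape a b c p₁ p₂ q₁ q₂) (hb : 0 < b) (hc : 0 < c) {i j i' j' : ℤ}
    (h : InL p₁ p₂ q₁ q₂ i j) (hi' : 0 ≤ i') (hj' : 0 ≤ j')
    (hd : a ∣ b * (i' - i) + c * (j' - j)) : b * i + c * j ≤ b * i' + c * j' := by
  have e0 : 0 ≤ b * i' + c * j' := by positivity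
  obtain ⟨k, l, hin, hle, hd'⟩ := H.exists_reduction hb hc (b * i' + c * j').toNat i' j' hi' hj'
    (by omega)
  obtain ⟨rfl, rfl⟩ := H.eq_of_dvd h hin (by
    exact (dvd_sub hd' hd).trans (dvd_of_eq (by ring)))
  exact hle

theorem frobeniusNumber {a b c : ℕ} (H : LShape a b c p₁ p₂ q₁ q₂) (ha : 2 ≤ a) (hab : a < b)
    (hbc : b < c) (hcop : Nat.Coprime a b) :
    ∃ g : ℕ, FrobeniusNumber g {a, b, c} ∧
      (g : ℤ) + a = max (b * (p₁ - 1) + c * (q₂ - p₂ - 1)) (b * (p₁ - q₁ - 1) + c * (q₂ - 1)) := by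
  have hb : (0 : ℤ) < b := by omega
  have hc : (0 : ℤ) < c := by omega
  have hq := H.q₁_nonneg
  have hp := H.p₂_nonneg
  have hq' := H.q₁_lt
  have hp' := H.p₂_lt
  set M : ℤ := max (b * (p₁ - 1) + c * (q₂ - p₂ - 1)) (b * (p₁ - q₁ - 1) + c * (q₂ - 1)) with hM
  have upper : ∀ i j : ℤ, InL p₁ p₂ q₁ q₂ i j → b * i + c * j ≤ M := by
    rintro i j ⟨h1, h2, h3, h4, h5 | h5⟩
    · refine le_trans (add_le_add (mul_le_mul_of_nonneg_left (by omega) hb.le)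
        (mul_le_mul_of_nonneg_left (by omega) hc.le)) (le_max_right _ _)
    · refine le_trans (add_le_add (mul_le_mul_of_nonneg_left (by omega) hb.le)
        (mul_le_mul_of_nonneg_left (by omega) hc.le)) (le_max_left _ _)
  obtain ⟨i₀, j₀, hin₀, hM₀⟩ : ∃ i j : ℤ, InL p₁ p₂ q₁ q₂ i j ∧ M = b * i + c * j := by
    rcases max_choice ((b : ℤ) * (p₁ - 1) + c * (q₂ - p₂ - 1))
      (b * (p₁ - q₁ - 1) + c * (q₂ - 1)) with h | h
    · exact ⟨_, _, ⟨by omega, by omega, by omega, by omega, by omega⟩, h⟩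
    · exact ⟨_, _, ⟨by omega, by omega, by omega, by omega, by omega⟩, h⟩
  have cover : ∀ n : ℤ, ∃ i j : ℕ, ((b * i + c * j : ℕ) : ℤ) ≤ M ∧
      (a : ℤ) ∣ n - (b * i + c * j : ℕ) := by
    intro n
    obtain ⟨s, t, hst⟩ := (Nat.isCoprime_iff_coprime.2 hcop)
    have ha' : (0 : ℤ) < a := by omega
    have hi : 0 ≤ (n * t) % a := Int.emod_nonneg _ ha'.ne'
    have e0 : 0 ≤ (b : ℤ) * ((n * t) % a) + c * 0 := by positivity
    obtain ⟨k, l, hin, -, hd⟩ := H.exists_reduction hb hc (b * ((n * t) % a) + c * 0).toNat _ 0 hi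
      le_rfl (by omega)
    have hk := hin.1
    have hl := hin.2.1
    lift k to ℕ using hk
    lift l to ℕ using hl
    refine ⟨k, l, by push_cast; exact upper _ _ hin, ?_⟩
    have h1 : (a : ℤ) ∣ n - b * ((n * t) % a) := by
      have e : (n * t) % a = n * t - a * ((n * t) / a) := by
        have := Int.emod_add_mul_ediv (n * t) a; linarith
      rw [e]
      refine ⟨n * s + b * ((n * t) / a), ?_⟩
      linear_combination (-n) * hst
    exact (dvd_add h1 hd).trans (dvd_of_eq (by push_cast; ring))
  -- Otherwise the class of 1 would have a representative in [0, a), hence 1 itself, impossible as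
  -- b, c > 1. So `(M - a).toNat` below is not truncated.
  have hMa : (a : ℤ) ≤ M := by
    obtain ⟨i, j, hle, d, hd⟩ := cover 1
    by_contra! hlt
    have hpos : ((b * i + c * j : ℕ) : ℤ) = 1 - a * d := by linarith
    have hd0 : d = 0 := by
      have h1 : (0 : ℤ) ≤ ((b * i + c * j : ℕ) : ℤ) := by positivity
      have h2 : d < 1 := by nlinarith
      have h3 : -1 < d := by nlinarith
      omega
    rw [hd0] at hpos
    have hpos' : b * i + c * j = 1 := by zify; push_cast at hpos; linarith
    rcases Nat.eq_zero_or_pos i with rfl | hi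
    · rcases Nat.eq_zero_or_pos j with rfl | hj
      · simp at hpos'
      · nlinarith
    · nlinarith
  refine ⟨(M - a).toNat, ?_, by omega⟩
  rw [frobeniusNumber_iff]
  constructor
  · rw [mem_closure_triple]
    rintro ⟨i, j, k, h⟩
    have h' : M = a * i + b * j + c * k + a := by
      have : ((M - a).toNat : ℤ) = a * i + b * j + c * k := by exact_mod_cast h
      omega
    have := H.le_of_dvd hb hc hin₀ (i' := j) (j' := k) (by positivity) (by positivity)
      ⟨-(i + 1), by linarith⟩
    have h0 : (0 : ℤ) ≤ a * i := by positivity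
    linarith
  · intro k hk
    rw [mem_closure_triple]
    obtain ⟨i, j, hle, d, hd⟩ := cover k
    have hd0 : 0 ≤ d := by
      by_contra! hneg
      have hkM : M - a < k := by omega
      nlinarith
    lift d to ℕ using hd0
    refine ⟨d, i, j, ?_⟩
    have : (k : ℤ) = a * d + b * i + c * j := by push_cast at hd; linarith
    exact_mod_cast this

end LShape

end Frob3

/-! ### Lattice vectors with first coordinate in (0, r] -/

namespace Frob3

/-- The first coordinate of the lattice vector `(⌊u i / r⌋ + 1) (r, -q) - i (u, h)`. -/
def seqX (r u i : ℤ) : ℤ := r * (u * i / r + 1) - u * i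

/-- The second coordinate, negated, of the vector `(⌊u i / r⌋ + 1) (r, -q) - i (u, h)`. -/
def seqY (r q u h i : ℤ) : ℤ := q * (u * i / r + 1) + h * i

/-- `(r, -q)` and `(u, h)` are a basis of the lattice of all `(X, Y)` with `a ∣ b X + c Y`. -/
structure LatticeBasis (a b c r q u h : ℤ) : Prop where
  u_pos : 0 < u
  u_lt : u < r
  q_pos : 0 < q
  h_pos : 0 < h
  det : r * h + q * u = a
  coprime : IsCoprime a b
  coprime' : IsCoprime a c
  b_pos : 0 < b
  b_lt : b < c
  dvd_v : a ∣ b * r - c * q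
  dvd_u : a ∣ b * u + c * h
  pos_v : c * q < b * r

/-- The weight `b x - c y` is positive at the indices `0, …, N - 1` and negative at `N`. -/
structure FirstNeg (b c r q u h N : ℤ) : Prop where
  pos : 0 < N
  before : ∀ i : ℤ, 0 ≤ i → i < N → c * seqY r q u h i < b * seqX r u i
  at_N : b * seqX r u N < c * seqY r q u h N

namespace LatticeBasis

variable {a b c r q u h N m : ℤ}

theorem r_pos (H : LatticeBasis a b c r q u h) : 0 < r := H.u_pos.trans H.u_lt

theorem r_le (H : LatticeBasis a b c r q u h) : r ≤ a := by
  have := H.det; have := H.r_pos; have := H.h_pos; have := H.q_pos; have := H.u_pos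
  nlinarith [mul_pos H.q_pos H.u_pos]

theorem a_pos (H : LatticeBasis a b c r q u h) : 0 < a := H.r_pos.trans_le H.r_le

theorem floor_bounds (H : LatticeBasis a b c r q u h) (i : ℤ) :
    r * (u * i / r) ≤ u * i ∧ u * i < r * (u * i / r + 1) := by
  have h1 := Int.mul_ediv_self_le (x := u * i) (k := r) H.r_pos.ne'
  have h2 := Int.lt_mul_ediv_self_add (x := u * i) (k := r) H.r_pos
  exact ⟨h1, by linarith⟩

theorem seqX_pos (H : LatticeBasis a b c r q u h) (i : ℤ) : 0 < seqX r u i := by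
  have := H.floor_bounds i
  simp only [seqX]; linarith

theorem seqX_le (H : LatticeBasis a b c r q u h) (i : ℤ) : seqX r u i ≤ r := by
  have := H.floor_bounds i
  simp only [seqX]; linarith

theorem floor_eq (H : LatticeBasis a b c r q u h) {s i : ℤ} (h0 : 0 < r * s - u * i)
    (h1 : r * s - u * i ≤ r) : u * i / r + 1 = s := by
  obtain ⟨h2, h3⟩ := H.floor_bounds i
  have hr := H.r_pos
  have e1 : u * i / r < s := by
    by_contra! hle
    nlinarith
  have e2 : s < u * i / r + 2 := by
    by_contra! hle
    nlinarith
  omega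

theorem seqX_zero : seqX r u 0 = r := by simp [seqX]

theorem seqY_zero : seqY r q u h 0 = q := by simp [seqY]

theorem seqX_one (H : LatticeBasis a b c r q u h) : seqX r u 1 = r - u := by
  simp [seqX, Int.ediv_eq_zero_of_lt H.u_pos.le H.u_lt]

theorem seqY_one (H : LatticeBasis a b c r q u h) : seqY r q u h 1 = q + h := by
  simp [seqY, Int.ediv_eq_zero_of_lt H.u_pos.le H.u_lt]

theorem seqX_r (H : LatticeBasis a b c r q u h) : seqX r u r = r := by
  simp only [seqX, Int.mul_ediv_cancel _ H.r_pos.ne']; ring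

theorem seqY_r (H : LatticeBasis a b c r q u h) : seqY r q u h r = q + a := by
  simp only [seqY, Int.mul_ediv_cancel _ H.r_pos.ne', ← H.det]; ring

theorem seqY_lt (H : LatticeBasis a b c r q u h) {i j : ℤ} (hij : i < j) :
    seqY r q u h i < seqY r q u h j := by
  have h1 : u * i / r ≤ u * j / r :=
    Int.ediv_le_ediv H.r_pos (mul_le_mul_of_nonneg_left hij.le H.u_pos.le)
  have h2 := mul_le_mul_of_nonneg_left h1 H.q_pos.le
  have h3 := mul_lt_mul_of_pos_left hij H.h_pos
  simp only [seqY]; linarith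

theorem seqY_le (H : LatticeBasis a b c r q u h) {i j : ℤ} (hij : i ≤ j) :
    seqY r q u h i ≤ seqY r q u h j := by
  rcases hij.eq_or_lt with rfl | hlt
  · exact le_rfl
  · exact (H.seqY_lt hlt).le

theorem lt_of_seqY_lt (H : LatticeBasis a b c r q u h) {i j : ℤ}
    (hij : seqY r q u h i < seqY r q u h j) : i < j := by
  by_contra! hle
  exact absurd (H.seqY_le hle) (not_le.2 hij)

theorem le_seqY (H : LatticeBasis a b c r q u h) {i : ℤ} (hi : 0 ≤ i) :
    q ≤ seqY r q u h i := by
  have := H.seqY_le hi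
  rwa [seqY_zero] at this

theorem seqY_pos (H : LatticeBasis a b c r q u h) {i : ℤ} (hi : 0 ≤ i) :
    0 < seqY r q u h i := H.q_pos.trans_le (H.le_seqY hi)

theorem dvd_seq (H : LatticeBasis a b c r q u h) (i : ℤ) :
    a ∣ b * seqX r u i - c * seqY r q u h i := by
  have := dvd_sub (H.dvd_v.mul_right (u * i / r + 1)) (H.dvd_u.mul_right i)
  exact this.trans (dvd_of_eq (by simp only [seqX, seqY]; ring))

/-- Cramer's rule: the determinant is a, and it divides both numerators because b is invertible
modulo a. -/
theorem exists_coords (H : LatticeBasis a b c r q u h) {X Y : ℤ} (hd : a ∣ b * X - c * Y) :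
    ∃ s i : ℤ, X = r * s - u * i ∧ Y = q * s + h * i := by
  obtain ⟨i, hi⟩ : a ∣ r * Y - q * X := by
    refine H.coprime.dvd_of_dvd_mul_left ?_
    exact (dvd_sub (H.dvd_v.mul_right Y) (hd.mul_right q)).trans (dvd_of_eq (by ring))
  obtain ⟨s, hs⟩ : a ∣ h * X + u * Y := by
    refine H.coprime.dvd_of_dvd_mul_left ?_
    exact (dvd_add (H.dvd_u.mul_right Y) (hd.mul_right h)).trans (dvd_of_eq (by ring))
  have hdet := H.det
  refine ⟨s, i, mul_left_cancel₀ H.a_pos.ne' ?_, mul_left_cancel₀ H.a_pos.ne' ?_⟩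
  · linear_combination (-X) * hdet + r * hs - u * hi
  · linear_combination (-Y) * hdet + q * hs + h * hi

theorem exists_index (H : LatticeBasis a b c r q u h) {X Y : ℤ} (hd : a ∣ b * X - c * Y)
    (hX : 0 < X) (hXr : X ≤ r) (hY : 0 ≤ Y) :
    ∃ i : ℤ, 0 ≤ i ∧ X = seqX r u i ∧ Y = seqY r q u h i := by
  obtain ⟨s, i, rfl, rfl⟩ := H.exists_coords hd
  have hs := H.floor_eq hX hXr
  refine ⟨i, ?_, by rw [seqX, hs], by rw [seqY, hs]⟩
  by_contra! hi
  have h1 := mul_pos_of_neg_of_neg (neg_lt_zero.2 H.u_pos) hi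
  have h2 := mul_pos_of_neg_of_neg (neg_lt_zero.2 H.h_pos) hi
  have hr := H.r_pos
  have hq := H.q_pos
  have hs1 : s < 1 := by by_contra! hle; nlinarith
  have hs0 : 0 < s := by by_contra! hle; nlinarith
  omega

theorem seq_add (H : LatticeBasis a b c r q u h) {i j : ℤ} (hle : seqX r u i + seqX r u j ≤ r) :
    seqX r u (i + j) = seqX r u i + seqX r u j ∧
      seqY r q u h (i + j) = seqY r q u h i + seqY r q u h j := by
  have h1 := H.seqX_pos i
  have h2 := H.seqX_pos j
  have hs := H.floor_eq (s := (u * i / r + 1) + (u * j / r + 1)) (i := i + j)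
    (by simp only [seqX] at *; linarith) (by simp only [seqX] at *; linarith)
  simp only [seqX, seqY, hs]
  constructor <;> ring

theorem seq_sub (H : LatticeBasis a b c r q u h) {i j : ℤ} (hlt : seqX r u j < seqX r u i) :
    seqX r u (i - j) = seqX r u i - seqX r u j ∧
      seqY r q u h (i - j) = seqY r q u h i - seqY r q u h j := by
  have h1 := H.seqX_le i
  have h2 := H.seqX_pos j
  have hs := H.floor_eq (s := (u * i / r + 1) - (u * j / r + 1)) (i := i - j)
    (by simp only [seqX] at *; linarith) (by simp only [seqX] at *; linarith)
  simp only [seqX, seqY, hs]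
  constructor <;> ring

theorem seq_succ (H : LatticeBasis a b c r q u h) (i : ℤ) :
    (seqX r u (i + 1) = seqX r u i - u ∧ seqY r q u h (i + 1) = seqY r q u h i + h) ∨
      (seqX r u (i + 1) = seqX r u i - u + r ∧
        seqY r q u h (i + 1) = seqY r q u h i + h + q) := by
  have h1 := H.seqX_pos i
  have h2 := H.seqX_le i
  have h3 := H.u_pos
  have h4 := H.u_lt
  rcases lt_or_ge u (seqX r u i) with hlt | hge
  · left
    have hs := H.floor_eq (s := u * i / r + 1) (i := i + 1)
      (by simp only [seqX] at *; linarith) (by simp only [seqX] at *; linarith)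
    simp only [seqX, seqY, hs]
    constructor <;> ring
  · right
    have hs := H.floor_eq (s := u * i / r + 1 + 1) (i := i + 1)
      (by simp only [seqX] at *; linarith) (by simp only [seqX] at *; linarith)
    simp only [seqX, seqY, hs]
    constructor <;> ring

theorem dvd_of_seqX_eq (H : LatticeBasis a b c r q u h) {i j : ℤ}
    (he : seqX r u i = seqX r u j) : a ∣ seqY r q u h i - seqY r q u h j := by
  refine H.coprime'.dvd_of_dvd_mul_left ?_
  exact (dvd_sub (H.dvd_seq j) (H.dvd_seq i)).trans (dvd_of_eq (by rw [he]; ring))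

theorem seqX_ne (H : LatticeBasis a b c r q u h) {i j : ℤ} (hij : i < j)
    (hy : seqY r q u h j - seqY r q u h i < a) : seqX r u i ≠ seqX r u j := by
  intro he
  have := Int.le_of_dvd (by have := H.seqY_lt hij; linarith) (H.dvd_of_seqX_eq he.symm)
  linarith

/-- At index r the vector is (r, -(q + a)), whose weight is negative since r ≤ a and b < c. -/
theorem index_le (H : LatticeBasis a b c r q u h) (F : FirstNeg b c r q u h N) : N ≤ r := by
  by_contra! hlt
  have h1 := F.before r H.r_pos.le hlt
  rw [H.seqX_r, H.seqY_r] at h1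
  have h2 := mul_le_mul_of_nonneg_left H.r_le H.b_pos.le
  have h3 := mul_lt_mul_of_pos_right H.b_lt H.a_pos
  have h4 := mul_pos (H.b_pos.trans H.b_lt) H.q_pos
  linarith

/-- A wrapping step would add the vector of index 1; for N > 1 that has positive weight, so the
weight could not turn negative. -/
theorem seq_firstNeg (H : LatticeBasis a b c r q u h) (F : FirstNeg b c r q u h N) :
    seqX r u N = seqX r u (N - 1) - u ∧ seqY r q u h N = seqY r q u h (N - 1) + h := by
  have hs := H.seq_succ (N - 1)
  rw [sub_add_cancel] at hs
  refine hs.resolve_right ?_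
  rintro ⟨h1, h2⟩
  have hN := F.pos
  have h3 := F.before (N - 1) (by omega) (by omega)
  have h4 := F.at_N
  rw [h1, h2] at h4
  obtain hlt | rfl : 1 < N ∨ N = 1 := by omega
  · have h5 := F.before 1 (by omega) hlt
    rw [H.seqX_one, H.seqY_one] at h5
    linarith
  · rw [sub_self, H.seqX_one, seqX_zero] at h1
    linarith [H.r_pos]

theorem seqY_le_a (H : LatticeBasis a b c r q u h) (F : FirstNeg b c r q u h N) :
    seqY r q u h N ≤ a := by
  have h1 := H.index_le F
  have h2 := (H.seq_firstNeg F).1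
  have h3 := H.seqX_le (N - 1)
  have h4 : u * N ≤ u * r := mul_le_mul_of_nonneg_left h1 H.u_pos.le
  have h5 : h * N ≤ h * r := mul_le_mul_of_nonneg_left h1 H.h_pos.le
  have h6 : seqX r u N ≤ r - u := by linarith
  simp only [seqX] at h6
  have hr := H.r_pos
  have hu := H.u_pos
  have h7 : u * N / r + 1 < u + 1 := by
    by_contra! hle
    nlinarith
  have h8 : q * (u * N / r + 1) ≤ q * u := mul_le_mul_of_nonneg_left (by omega) H.q_pos.le
  simp only [seqY]
  linarith [H.det]

theorem seqX_ne_of_le (H : LatticeBasis a b c r q u h) (F : FirstNeg b c r q u h N) {i j : ℤ}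
    (hi : 0 ≤ i) (hij : i < j) (hj : j ≤ N) : seqX r u i ≠ seqX r u j := by
  refine H.seqX_ne hij ?_
  have := H.seqY_le hj
  have := H.seqY_pos hi
  have := H.seqY_le_a F
  linarith

/-- If x_N > x_m, the vector at N would be the sum of those at m and N - m, both of positive weight.
-/
theorem seqX_firstNeg_lt (H : LatticeBasis a b c r q u h) (F : FirstNeg b c r q u h N)
    (hm : 0 ≤ m) (hmN : m < N) (hmin : ∀ i, 0 ≤ i → i < N → seqX r u m ≤ seqX r u i) :
    seqX r u N < seqX r u m := by
  refine lt_of_le_of_ne ?_ (H.seqX_ne_of_le F hm hmN le_rfl).symm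
  by_contra! hlt
  rcases hm.eq_or_lt with rfl | hm
  · have := H.seqX_le N
    rw [seqX_zero] at hlt
    linarith
  · obtain ⟨h1, h2⟩ := H.seq_sub (q := q) (h := h) hlt
    have h3 := F.before (N - m) (by omega) (by omega)
    have h4 := F.before m hm.le hmN
    have h5 := F.at_N
    rw [h1, h2] at h3
    linarith

theorem lShape (H : LatticeBasis a b c r q u h) (F : FirstNeg b c r q u h N)
    (hm : 0 ≤ m) (hmN : m < N) (hmin : ∀ i, 0 ≤ i → i < N → seqX r u m ≤ seqX r u i) :
    LShape a b c (seqX r u m) (seqY r q u h m) (seqX r u N) (seqY r q u h N) := by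
  have hlt := H.seqX_firstNeg_lt F hm hmN hmin
  -- Minimality of x_m empties this box of lattice vectors. Both separation axioms reduce to it,
  -- after translating by the vector at N or reflecting in the one at m where necessary.
  have ext : ∀ X Y : ℤ, a ∣ b * X - c * Y → 0 < X → X < seqX r u m → 0 ≤ Y →
      Y < seqY r q u h N → False := by
    intro X Y hd hX hXm hY hYN
    obtain ⟨i, hi, rfl, rfl⟩ := H.exists_index hd hX (hXm.le.trans (H.seqX_le m)) hY
    have := hmin i hi (H.lt_of_seqY_lt hYN)
    omega
  refine ⟨(H.seqX_pos N).le, hlt, (H.seqY_pos hm).le, H.seqY_lt hmN, H.dvd_seq m, ?_,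
    F.before m hm hmN, F.at_N, ?_, ?_⟩
  · exact ((dvd_neg (α := ℤ)).2 (H.dvd_seq N)).trans (dvd_of_eq (by ring))
  · intro X Y hd hX hXm hY hYN
    rcases hX.lt_or_eq with hX | rfl
    · exact (ext X (-Y) (hd.trans (dvd_of_eq (by ring))) hX hXm (by omega) hYN).elim
    · refine ⟨rfl, ?_⟩
      by_contra hne
      have h1 : a ∣ -Y := H.coprime'.dvd_of_dvd_mul_left
        (((dvd_neg (α := ℤ)).2 hd).trans (dvd_of_eq (by ring)))
      have := Int.le_of_dvd (by omega) h1
      have := H.seqY_le_a F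
      omega
  · intro X Y hd hX hXm hY hYN
    constructor
    · by_contra! hlt'
      exact ext (X + seqX r u N) (seqY r q u h N - Y)
        ((dvd_add hd (H.dvd_seq N)).trans (dvd_of_eq (by ring)))
        (by linarith [H.seqX_pos N]) (by linarith) (by linarith) (by linarith)
    · by_contra! hlt'
      exact ext (seqX r u m - X) (seqY r q u h m + Y)
        ((dvd_sub (H.dvd_seq m) hd).trans (dvd_of_eq (by ring)))
        (by linarith) (by linarith) (by linarith [H.seqY_pos hm]) (by linarith)

theorem pred_of_min (H : LatticeBasis a b c r q u h)
    (hmin : seqX r u m ≤ seqX r u (m - 1)) :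
    seqX r u m = seqX r u (m - 1) - u := by
  have hs := H.seq_succ (m - 1)
  rw [sub_add_cancel] at hs
  rcases hs with hs | hs
  · exact hs.1
  · linarith [hs.1, H.u_lt]

/-- If j + m ≥ N, then j + m and k share a first coordinate, so their y-values differ by at least a.
That is too much for the positive weights at j and m. This bounds w from above. -/
theorem add_lt_of_mem (H : LatticeBasis a b c r q u h) (F : FirstNeg b c r q u h N) {j k : ℤ}
    (hk : 0 ≤ k) (hkN : k < N) (hj : 0 ≤ j) (hjN : j < N) (hm : 0 ≤ m) (hmN : m < N)
    (he : seqX r u j + seqX r u m = seqX r u k) : j + m < N := by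
  by_contra! hle
  obtain ⟨h1, h2⟩ := H.seq_add (q := q) (h := h) (he.le.trans (H.seqX_le k))
  have h3 : seqY r q u h (j + m) - seqY r q u h k < a := by
    by_contra! h4
    have h5 := F.before j hj hjN
    have h6 := F.before m hm hmN
    have h7 := H.seqY_pos hk
    have h8 : c * a < c * seqY r q u h (j + m) :=
      mul_lt_mul_of_pos_left (by linarith) (H.b_pos.trans H.b_lt)
    have h9 : b * seqX r u k ≤ b * a :=
      mul_le_mul_of_nonneg_left ((H.seqX_le k).trans H.r_le) H.b_pos.le
    have h10 := mul_lt_mul_of_pos_right H.b_lt H.a_pos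
    have h11 : b * seqX r u k = b * seqX r u j + b * seqX r u m := by rw [← he]; ring
    rw [h2] at h8
    linarith
  exact H.seqX_ne (by omega : k < j + m) h3 (by rw [h1, he])

end LatticeBasis

end Frob3

/-! ### The set 𝒳 and the index μ -/

namespace Frob3

namespace LatticeBasis

theorem exists_min {r u : ℤ} (n : ℕ) :
    ∃ m : ℕ, m ≤ n ∧ ∀ i : ℤ, 0 ≤ i → i < (n : ℤ) + 1 → seqX r u m ≤ seqX r u i := by
  obtain ⟨m, hm, hmin⟩ := Finset.exists_min_image (Finset.range (n + 1))
    (fun i : ℕ => seqX r u i) ⟨0, by simp⟩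
  refine ⟨m, by simpa [Nat.lt_succ_iff] using hm, fun i hi hin => ?_⟩
  lift i to ℕ using hi
  exact hmin i (by simp; omega)

/-- A smaller representative b n₁ + c n₂ gives the vector (x_i - n₁, -n₂) at some index j < i; for
n₁ > 0 the difference, at index i - j < N, would have negative weight. -/
theorem minRep_seqX {a b c : ℕ} {r q u h N : ℤ} (H : LatticeBasis a b c r q u h)
    (F : FirstNeg b c r q u h N) {i : ℤ} (hi : 0 ≤ i) (hiN : i < N) :
    (minRep a b c (b * seqX r u i) : ℤ) = c * seqY r q u h i := by
  have hb := H.b_pos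
  have hc := H.b_pos.trans H.b_lt
  have hypos := H.seqY_pos hi
  obtain ⟨y, hy⟩ : ∃ y : ℕ, (y : ℤ) = seqY r q u h i := ⟨_, Int.toNat_of_nonneg hypos.le⟩
  have hw := F.before i hi hiN
  have hy0 : 0 < y := by omega
  suffices minRep a b c (b * seqX r u i) = c * y by rw [this, ← hy]; push_cast; rfl
  refine (IsLeast.csInf_eq (a := c * y) ⟨⟨?_, ⟨0, y, by ring⟩, ?_⟩, ?_⟩)
  · exact Nat.mul_pos (by exact_mod_cast hc) hy0
  · rw [Int.modEq_iff_dvd]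
    push_cast
    rw [hy]
    exact H.dvd_seq i
  · rintro z ⟨-, ⟨n₁, n₂, rfl⟩, hz⟩
    by_contra! hlt
    zify at hlt
    rw [hy] at hlt
    have hn1 : (0 : ℤ) ≤ n₁ := by positivity
    have hn2 : (0 : ℤ) ≤ n₂ := by positivity
    have hcn2 : (0 : ℤ) ≤ c * n₂ := by positivity
    have hbn1 : (0 : ℤ) ≤ b * n₁ := by positivity
    rw [Int.modEq_iff_dvd] at hz
    push_cast at hz
    obtain ⟨j, hj, hx, hn⟩ := H.exists_index (X := seqX r u i - n₁) (Y := n₂)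
      (hz.trans (dvd_of_eq (by ring)))
      (sub_pos.2 (lt_of_mul_lt_mul_left (by linarith) hb.le)) (by linarith [H.seqX_le i]) hn2
    have hji : j < i := by
      refine H.lt_of_seqY_lt (q := q) (h := h) ?_
      rw [← hn]
      exact lt_of_mul_lt_mul_left (by linarith) hc.le
    rcases hn1.lt_or_eq with hn1 | hn1
    · obtain ⟨h1, h2⟩ := H.seq_sub (i := i) (j := j) (by linarith)
      have h3 := F.before (i - j) (by omega) (by omega)
      rw [h1, h2, ← hx, ← hn] at h3
      linarith
    · exact H.seqX_ne_of_le F hj hji hiN.le (by rw [← hx, ← hn1]; ring)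

theorem mem_setX {a b c : ℕ} {r q u h N : ℤ} (H : LatticeBasis a b c r q u h)
    (F : FirstNeg b c r q u h N) {z : ℤ} :
    z ∈ setX a b c r ↔ ∃ i : ℤ, 0 ≤ i ∧ i < N ∧ z = seqX r u i := by
  have hb := H.b_pos
  have hc := H.b_pos.trans H.b_lt
  constructor
  · rintro ⟨hz, hzr, hmod⟩
    have hbz : 0 < (b : ℤ) * z := mul_pos hb (by omega)
    have hmem : ((b : ℤ) * z).toNat ∈ {v : ℕ | 0 < v ∧
        (∃ n₁ n₂ : ℕ, v = b * n₁ + c * n₂) ∧ (v : ℤ) ≡ b * z [ZMOD a]} := by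
      refine ⟨by omega, ⟨z.toNat, 0, ?_⟩, by rw [Int.toNat_of_nonneg hbz.le]⟩
      zify
      rw [Int.toNat_of_nonneg hbz.le, Int.toNat_of_nonneg (by omega)]
      ring
    obtain ⟨hpos, -, hcong⟩ := Nat.sInf_mem ⟨_, hmem⟩
    have hle := Nat.sInf_le hmem
    change (minRep a b c (b * z) : ℤ) ≡ b * z [ZMOD a] at hcong
    change minRep a b c (b * z) ≤ _ at hle
    obtain ⟨y, hy⟩ := Int.modEq_zero_iff_dvd.1 hmod
    have hy0 : 0 ≤ y := by
      by_contra! hneg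
      have := mul_neg_of_pos_of_neg hc hneg
      omega
    rw [Int.modEq_iff_dvd, hy] at hcong
    obtain ⟨i, hi, rfl, rfl⟩ := H.exists_index hcong (by omega) hzr hy0
    refine ⟨i, hi, ?_, rfl⟩
    by_contra! hNi
    have h1 := H.seqY_le hNi
    -- For i ≥ N, trading c y_N for the cheaper b x_N beats c y_i.
    obtain ⟨n₁, e₁⟩ : ∃ n : ℕ, (n : ℤ) = seqX r u N := ⟨_, Int.toNat_of_nonneg (H.seqX_pos N).le⟩
    obtain ⟨n₂, e₂⟩ : ∃ n : ℕ, (n : ℤ) = seqY r q u h i - seqY r q u h N :=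
      ⟨_, Int.toNat_of_nonneg (by omega)⟩
    have hn1 : (0 : ℤ) < b * n₁ := by rw [e₁]; exact mul_pos hb (H.seqX_pos N)
    have hn2 : (0 : ℤ) ≤ c * n₂ := by positivity
    have hle' : minRep a b c (b * seqX r u i) ≤ b * n₁ + c * n₂ := by
      refine Nat.sInf_le ⟨by zify; linarith, ⟨n₁, n₂, rfl⟩, ?_⟩
      rw [Int.modEq_iff_dvd]
      push_cast
      rw [e₁, e₂]
      exact (dvd_sub (H.dvd_seq i) (H.dvd_seq N)).trans (dvd_of_eq (by ring))
    zify at hle'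
    rw [hy, e₁, e₂] at hle'
    linarith [F.at_N]
  · rintro ⟨i, hi, hiN, rfl⟩
    refine ⟨H.seqX_pos i, H.seqX_le i, ?_⟩
    rw [H.minRep_seqX F hi hiN, Int.modEq_zero_iff_dvd]
    exact dvd_mul_right _ _

theorem weight_ne {a b c r q u h : ℤ} (H : LatticeBasis a b c r q u h) (hbc : IsCoprime b c)
    (hac : a < c) (i : ℤ) : b * seqX r u i ≠ c * seqY r q u h i := by
  intro he
  have h1 : c ∣ seqX r u i := hbc.symm.dvd_of_dvd_mul_left ⟨_, he⟩
  have := Int.le_of_dvd (H.seqX_pos i) h1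
  linarith [H.seqX_le i, H.r_le]

/-- Positive weight says the left floor is at most the right one; the opposite inequality always
holds, as r (b u + c h) - u (b r - c q) = c a. -/
theorem weight_pos_iff {a b c r q u h : ℤ} (H : LatticeBasis a b c r q u h)
    {i : ℤ} (hi : 0 ≤ i) :
    c * seqY r q u h i < b * seqX r u i ↔
      i * (b * u + c * h) / (b * r - c * q) = i * u / r := by
  have hA : 0 < b * r - c * q := by linarith [H.pos_v]
  have hfl := H.floor_bounds i
  have hr := H.r_pos
  have hc := H.b_pos.trans H.b_lt
  have hlow : u * i / r ≤ i * (b * u + c * h) / (b * r - c * q) := by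
    rw [Int.le_ediv_iff_mul_le hA]
    refine le_of_mul_le_mul_left ?_ hr
    have h1 := mul_le_mul_of_nonneg_right hfl.1 hA.le
    have h2 : 0 ≤ c * a * i := mul_nonneg (mul_nonneg hc.le H.a_pos.le) hi
    have := H.det
    subst this
    linarith
  rw [mul_comm i u]
  constructor
  · intro hw
    refine le_antisymm ?_ hlow
    refine Int.lt_add_one_iff.1 ((Int.ediv_lt_iff_lt_mul hA).2 ?_)
    simp only [seqX, seqY] at hw
    linarith
  · intro he
    have := Int.lt_ediv_add_one_mul_self (i * (b * u + c * h)) hA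
    rw [he] at this
    simp only [seqX, seqY]
    linarith

/-- Passing from (e, B) to (u, b u + c h) shifts both floors in `muSet` by the same integer (i + 1)
f. -/
theorem firstNeg_mu {a b c r q u h e B f : ℤ} (H : LatticeBasis a b c r q u h)
    (hbc : IsCoprime b c) (hac : a < c) (he : e = r * f + u)
    (hB : B = (b * u + c * h) + (b * r - c * q) * f) :
    FirstNeg b c r q u h ((mu (b * r - c * q) B e r : ℤ) + 1) := by
  have hA : 0 < b * r - c * q := by linarith [H.pos_v]
  have hr := H.r_pos
  have hc := H.b_pos.trans H.b_lt
  have hne : (muSet (b * r - c * q) B e r).Nonempty := by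
    refine muSet_nonempty hA hr ?_
    have := mul_pos hc H.a_pos
    have := H.det
    subst he hB
    nlinarith
  have key : ∀ i : ℕ, i ∈ muSet (b * r - c * q) B e r ↔
      ¬ (c * seqY r q u h ((i : ℤ) + 1) < b * seqX r u ((i : ℤ) + 1)) := by
    intro i
    rw [H.weight_pos_iff (by positivity)]
    refine not_congr ?_
    rw [hB, he, show ((i : ℤ) + 1) * ((b * u + c * h) + (b * r - c * q) * f) =
      ((i : ℤ) + 1) * (b * u + c * h) + (b * r - c * q) * (((i : ℤ) + 1) * f) by ring,
      show ((i : ℤ) + 1) * (r * f + u) = ((i : ℤ) + 1) * u + r * (((i : ℤ) + 1) * f) by ring,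
      Int.add_mul_ediv_left _ _ hA.ne', Int.add_mul_ediv_left _ _ hr.ne']
    exact add_left_inj _
  refine ⟨by positivity, ?_, ?_⟩
  · intro i hi hlt
    rcases hi.eq_or_lt with rfl | hi
    · rw [seqX_zero, seqY_zero]; exact H.pos_v
    · obtain ⟨j, rfl⟩ : ∃ j : ℕ, i = (j : ℤ) + 1 := ⟨(i - 1).toNat, by omega⟩
      have : j ∉ muSet (b * r - c * q) B e r := Nat.notMem_of_lt_sInf (by
        change j < mu _ _ _ _
        omega)
      rwa [key, not_not] at this
  · have := (key _).1 (Nat.sInf_mem hne)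
    exact lt_of_le_of_ne (not_lt.1 this) (H.weight_ne hbc hac _)

end LatticeBasis

end Frob3

/-! ### The basis attached to ℓ -/

namespace Frob3

theorem ell_lt {a b c : ℕ} (ha : 2 ≤ a) : ell a b c < a := by
  have : NeZero a := ⟨by omega⟩
  exact ZMod.val_lt _

theorem dvd_mul_ell_sub {a b c : ℕ} (ha : 2 ≤ a) (hab : Nat.Coprime a b) :
    (a : ℤ) ∣ b * ell a b c - c := by
  have : NeZero a := ⟨by omega⟩
  rw [← ZMod.intCast_zmod_eq_zero_iff_dvd]
  push_cast
  rw [ell, ZMod.natCast_zmod_val, mul_left_comm, ZMod.coe_mul_inv_eq_one b hab.symm, mul_one,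
    sub_self]

/-- Two Euclidean steps from (a, 0) and (a - ℓ, 1): (r, -q) = (a, 0) - q (a - ℓ, 1), then (u, h) =
(a - ℓ, 1) - (f + 1)(r, -q) with f = ⌊(a - ℓ - r) / r⌋. If u = 0, then r ≥ 2 would divide both a and
c. -/
theorem latticeBasis_of_ell {a b c : ℕ} (ha : 2 ≤ a) (hab : a < b) (hbc : b < c)
    (hcab : Nat.Coprime a b) (hcac : Nat.Coprime a c) {ℓ q r : ℤ} (hℓ : ℓ = ell a b c)
    (hq : q = a / (a - ℓ)) (hr : r = a - q * (a - ℓ)) (hrq : c * q < b * r) :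
    LatticeBasis a b c r q ((a - ℓ) % r) (q * ((a - ℓ - r) / r + 1) + 1) ∧
      0 < a - ℓ - r ∧ a - ℓ - r = r * ((a - ℓ - r) / r) + (a - ℓ) % r := by
  have hℓ0 : 0 ≤ ℓ := by omega
  have hℓa : ℓ < a := by have := ell_lt (b := b) (c := c) ha; omega
  have hd : (a : ℤ) ∣ b * ℓ - c := hℓ ▸ dvd_mul_ell_sub ha hcab
  have hd0 : (0 : ℤ) < a - ℓ := by omega
  have hq1 : 1 ≤ q := by rw [hq, Int.le_ediv_iff_mul_le hd0]; omega
  have hrmod : r = a % (a - ℓ) := by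
    have := Int.emod_add_mul_ediv a (a - ℓ)
    rw [← hq] at this
    linarith
  have hrlt : r < a - ℓ := by rw [hrmod]; exact Int.emod_lt_of_pos _ hd0
  have hr2 : 2 ≤ r := by
    by_contra! hlt
    have h1 : (b : ℤ) * r ≤ b * 1 := mul_le_mul_of_nonneg_left (by omega) (by omega)
    have h2 : (c : ℤ) * 1 ≤ c * q := mul_le_mul_of_nonneg_left hq1 (by omega)
    omega
  have hr0 : 0 < r := by omega
  have hf : 0 ≤ (a - ℓ - r) / r := Int.ediv_nonneg (by omega) hr0.le
  have he : a - ℓ - r = r * ((a - ℓ - r) / r) + (a - ℓ) % r := by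
    have h1 := Int.emod_add_mul_ediv (a - ℓ - r) r
    rw [Int.sub_emod_right] at h1
    linarith
  have hu0 : 0 < (a - ℓ) % r := by
    refine lt_of_le_of_ne (Int.emod_nonneg _ hr0.ne') fun h0 => ?_
    have h1 : r ∣ a - ℓ := Int.dvd_of_emod_eq_zero h0.symm
    have h2 : r ∣ a := (dvd_add (dvd_refl r) (h1.mul_left q)).trans (dvd_of_eq (by linarith))
    have h3 : r ∣ ℓ := (dvd_sub h2 h1).trans (dvd_of_eq (by ring))
    have h4 : r ∣ c :=
      (dvd_sub (h3.mul_left b) (h2.trans hd)).trans (dvd_of_eq (by ring))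
    have h5 := (Nat.isCoprime_iff_coprime.2 hcac).isUnit_of_dvd' h2 h4
    rcases Int.isUnit_iff.1 h5 with h | h <;> omega
  generalize hfe : (a - ℓ - r) / r = f at *
  generalize hue : (a - ℓ) % r = u at *
  have hdv : (a : ℤ) ∣ b * r - c * q := by
    rw [hr]
    exact (dvd_add (dvd_mul_right (a : ℤ) (b - b * q)) (hd.mul_right q)).trans
      (dvd_of_eq (by ring))
  refine ⟨⟨hu0, hue ▸ Int.emod_lt_of_pos _ hr0, by omega, by positivity, ?_,
    Nat.isCoprime_iff_coprime.2 hcab, Nat.isCoprime_iff_coprime.2 hcac, by omega, by omega,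
    hdv, ?_, hrq⟩, by omega, he⟩
  · linear_combination hr - q * he
  · have h1 := dvd_sub (dvd_sub (dvd_mul_right (a : ℤ) b) hd) (hdv.mul_right (f + 1))
    refine h1.trans (dvd_of_eq ?_)
    linear_combination b * he

end Frob3

/-! ### The formulas for g -/

open Frob3 in
theorem theorem5 (a b c : ℕ) (ha : 2 ≤ a) (hab : a < b) (hbc : b < c)
    (hcab : Nat.Coprime a b) (hcac : Nat.Coprime a c) (hcbc : Nat.Coprime b c)
    -- all quantities are integers; every divisor below is positive, so `/` is the floor of the
    -- quotient and `%` is the remainder in `{0, …, divisor - 1}`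
    (k ℓ q r u A B Λ Δ Λ' Δ' : ℤ) (μ : ℕ)
    (hk : k = (c : ℤ) / b)
    (hℓ : ℓ = Frob3.ell a b c)
    (hq : q = a / (a - ℓ))
    (hr : r = a - q * (a - ℓ))
    (hu : u = (a - ℓ) % r)
    (hA : A = b * r - c * q)
    (hB : B = b * (a - ℓ - r) + c * (q + 1))
    (hΛ : Λ = r / (a - ℓ - r))
    (hΔ : Δ = A / B)
    (hΛ' : Λ' = (a - ℓ - r) / r)
    (hΔ' : Δ' = B / A)
    (hμ : μ = Frob3.mu A B (a - ℓ - r) r)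
    (x y : ℕ → ℤ)
    (hx : ∀ i : ℕ, x i = r * ((a - ℓ - r) * i / r + 1) - (a - ℓ - r) * i)
    (hy : ∀ i : ℕ, y i = q * ((a - ℓ - r) * i / r + 1) + (q + 1) * i)
    (hkℓ : k < ℓ) (hrq : c * q < b * r) :
    ∃ g : ℕ, FrobeniusNumber g {a, b, c} ∧
      -- part (a), with its two special forms
      ((μ : ℤ) < r / u →
        (g : ℤ) + a =
          max (b * (r - μ * u - 1))
            (b * (u - 1) + c * (μ * (q + 1) + ((a - ℓ - r) * μ / r + 1) * q))
          + c * q * ((a - ℓ - 1) / r)) ∧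
      (Δ < Λ →
        (g : ℤ) + a =
          max (b * (r - Δ * (a - ℓ - r) - 1))
            (b * (a - ℓ - r - 1) + c * (Δ * (q + 1) + q))
          + c * q) ∧
      (Λ' < Δ' →
        (g : ℤ) + a =
          max (b * (r - 1)) (b * ((a - ℓ - 1) % r) + c * q)
          + c * q * ((a - ℓ - 1) / r)) ∧
      -- part (b)
      (r / u < (μ : ℤ) →
        Frob3.setX a b c r = {z : ℤ | ∃ i : ℕ, i ≤ μ ∧ z = x i} ∧
        (∃ m w : ℕ, m ≤ μ ∧ IsLeast (Frob3.setX a b c r) (x m) ∧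
          IsGreatest {j : ℕ | j ≤ μ ∧ x j + x m ∈ Frob3.setX a b c r} w) ∧
        ∀ m w : ℕ, m ≤ μ → IsLeast (Frob3.setX a b c r) (x m) →
          IsGreatest {j : ℕ | j ≤ μ ∧ x j + x m ∈ Frob3.setX a b c r} w →
          1 ≤ m ∧
          (g : ℤ) + a =
            max (b * (x m - 1) + c * y w) (b * (x (m - 1) - x μ - 1) + c * y μ)
            + c * q * ((a - ℓ - 1) / r)) := by
  obtain ⟨H, he0, he⟩ := latticeBasis_of_ell ha hab hbc hcab hcac hℓ hq hr hrq
  rw [← hu] at H he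
  generalize hee : a - ℓ - r = e at *
  have hℓ1 : (a : ℤ) - ℓ - 1 = (u - 1) + r * (e / r + 1) := by linarith
  have hr0 := H.r_pos
  have hu0 := H.u_pos
  have hur := H.u_lt
  have hq0 := H.q_pos
  have hdiv : ((a : ℤ) - ℓ - 1) / r = e / r + 1 := by
    rw [hℓ1, Int.add_mul_ediv_left _ _ hr0.ne', Int.ediv_eq_zero_of_lt (by omega) (by omega),
      zero_add]
  have hmod : ((a : ℤ) - ℓ - 1) % r = u - 1 := by
    rw [hℓ1, Int.add_mul_emod_self_left, Int.emod_eq_of_lt (by omega) (by omega)]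
  rw [hdiv, hmod]
  generalize hf : e / r = f at *
  set h : ℤ := q * (f + 1) + 1 with hh
  have hBf : B = (b * u + c * h) + (b * r - c * q) * f := by
    rw [hB, he, hh]; ring
  have F : FirstNeg b c r q u h ((μ : ℤ) + 1) := by
    rw [hμ, hA]
    exact H.firstNeg_mu (Nat.isCoprime_iff_coprime.2 hcbc) (by omega) he hBf
  have hfloor : ∀ i : ℤ, e * i / r = f * i + u * i / r := fun i => by
    rw [he, show (r * f + u) * i = u * i + r * (f * i) by ring,
      Int.add_mul_ediv_left _ _ hr0.ne', add_comm]
  have hxs : ∀ i : ℕ, x i = seqX r u i := fun i => by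
    rw [hx, hfloor, seqX, he]; ring
  have hys : ∀ i : ℕ, y i = seqY r q u h i := fun i => by
    rw [hy, hfloor, seqY, hh]; ring
  obtain ⟨hNx, hNy⟩ := H.seq_firstNeg F
  rw [add_sub_cancel_right] at hNx hNy
  have frob : ∀ m : ℕ, m ≤ μ → (∀ i, 0 ≤ i → i < (μ : ℤ) + 1 → seqX r u m ≤ seqX r u i) →
      ∃ g : ℕ, FrobeniusNumber g {a, b, c} ∧ (g : ℤ) + a =
        max (b * (seqX r u m - 1) + c * (seqY r q u h μ + h - seqY r q u h m - 1))
          (b * (seqX r u m - seqX r u μ + u - 1) + c * (seqY r q u h μ + h - 1)) := by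
    intro m hm hmin
    obtain ⟨g, hg, hga⟩ := (H.lShape F (by positivity) (by omega) hmin).frobeniusNumber ha hab hbc
      hcab
    refine ⟨g, hg, ?_⟩
    rw [hga, hNx, hNy]
    congr 2
    ring
  obtain ⟨m₀, hm₀, hmin₀⟩ := LatticeBasis.exists_min (r := r) (u := u) μ
  obtain ⟨g, hg, -⟩ := frob m₀ hm₀ hmin₀
  -- Uniqueness of the Frobenius number lets one g serve every minimising index.
  replace frob : ∀ m : ℕ, m ≤ μ →
      (∀ i, 0 ≤ i → i < (μ : ℤ) + 1 → seqX r u m ≤ seqX r u i) → (g : ℤ) + a =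
        max (b * (seqX r u m - 1) + c * (seqY r q u h μ + h - seqY r q u h m - 1))
          (b * (seqX r u m - seqX r u μ + u - 1) + c * (seqY r q u h μ + h - 1)) := by
    intro m hm hmin
    obtain ⟨g', hg', hga⟩ := frob m hm hmin
    rwa [IsGreatest.unique hg hg']
  have small : ∀ i : ℤ, 0 ≤ i → u * i < r → u * i / r = 0 := fun i hi hlt =>
    Int.ediv_eq_zero_of_lt (mul_nonneg hu0.le hi) hlt
  have first : (μ : ℤ) < r / u → (g : ℤ) + a =
      max (b * (r - μ * u - 1)) (b * (u - 1) + c * (μ * (q + 1) + (e * μ / r + 1) * q))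
        + c * q * (f + 1) := by
    intro hlt
    have hμr : u * (μ + 1) ≤ r := by
      have := (Int.le_ediv_iff_mul_le hu0).1 (Int.add_one_le_of_lt hlt)
      linarith
    have hi : ∀ i : ℤ, 0 ≤ i → i < (μ : ℤ) + 1 → u * i / r = 0 := fun i hi hiμ => by
      refine small i hi ?_
      have := mul_lt_mul_of_pos_left hiμ hu0
      linarith
    have hμ0 := hi μ (by positivity) (by omega)
    rw [frob μ le_rfl (fun i h0 h1 => by
      have := mul_le_mul_of_nonneg_left (Int.lt_add_one_iff.1 h1) hu0.le
      simp only [seqX, hμ0, hi i h0 h1]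
      linarith), ← max_add_add_right, hfloor]
    simp only [seqX, seqY, hμ0, hh]
    congr 1 <;> ring
  refine ⟨g, hg, first, ?_, ?_, ?_⟩
  · intro hlt
    have hA0 : 0 < A := by linarith
    have hB0 : 0 < B := by
      rw [hB]
      have h1 : 0 < b * e := mul_pos H.b_pos he0
      have h2 : 0 < c * (q + 1) := mul_pos (H.b_pos.trans H.b_lt) (by omega)
      linarith
    have hΔ0 : 0 ≤ Δ := hΔ ▸ Int.ediv_nonneg hA0.le hB0.le
    have hΔe : e * (Δ + 1) ≤ r := by
      have := (Int.le_ediv_iff_mul_le he0).1 (hΛ ▸ Int.add_one_le_of_lt hlt)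
      linarith
    -- Λ > Δ forces e ≤ r, and e = r is excluded by u > 0; so e = u, the weights before wrapping are
    -- A - iB, and μ = Δ.
    have hf0 : f = 0 := by
      have h1 : 0 ≤ f := hf ▸ Int.ediv_nonneg he0.le hr0.le
      have h2 : e * 1 ≤ e * (Δ + 1) := mul_le_mul_of_nonneg_left (by omega) he0.le
      by_contra hne
      have h3 : r * 1 ≤ r * f := mul_le_mul_of_nonneg_left (by omega) hr0.le
      linarith
    subst hf0
    obtain rfl : e = u := by linarith
    have hh1 : h = q + 1 := by rw [hh]; ring
    have hΔ1 : Δ * B ≤ A := by rw [hΔ]; exact Int.ediv_mul_le _ hB0.ne'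
    have hΔ2 : A < (Δ + 1) * B := by rw [hΔ]; exact Int.lt_ediv_add_one_mul_self _ hB0
    have weight : ∀ i : ℤ, b * (r * (0 + 1) - e * i) - c * (q * (0 + 1) + (q + 1) * i) =
        A - i * B := fun i => by rw [hA, hB]; ring
    have hμΔ : (μ : ℤ) = Δ := by
      rcases lt_trichotomy (μ : ℤ) Δ with hlt' | heq | hgt
      · exfalso
        have h1 : ((μ : ℤ) + 1) * B ≤ Δ * B := mul_le_mul_of_nonneg_right (by omega) hB0.le
        have h2 : e * ((μ : ℤ) + 1) ≤ e * Δ := mul_le_mul_of_nonneg_left (by omega) he0.le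
        have h3 := F.at_N
        simp only [seqX, seqY, small ((μ : ℤ) + 1) (by positivity) (by linarith), hh1] at h3
        have h4 := weight ((μ : ℤ) + 1)
        linarith
      · exact heq
      · exfalso
        rcases hΔe.lt_or_eq with hlt' | heq
        · have h3 := F.before (Δ + 1) (by omega) (by omega)
          simp only [seqX, seqY, small (Δ + 1) (by omega) hlt', hh1] at h3
          have h4 := weight (Δ + 1)
          linarith
        -- Boundary case: x_{Δ+1} = r = x_0 would be a repetition.
        · refine H.seqX_ne_of_le F le_rfl (by omega : 0 < Δ + 1) (by omega) ?_
          simp only [seqX, heq, Int.ediv_self hr0.ne', mul_zero, Int.zero_ediv]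
          ring
    have hlast : (μ : ℤ) < r / e := by rw [hμΔ, ← hΛ]; exact hlt
    have hfl : e * Δ / r = 0 := small Δ hΔ0 (by linarith)
    rw [first hlast, hμΔ, hfl]
    ring_nf
  · intro hlt
    have hμ0 : μ = 0 := by
      rw [hμ, mu, Nat.sInf_eq_zero]
      left
      simp only [muSet, Set.mem_ofPred_eq, Nat.cast_zero, zero_add, one_mul]
      omega
    have := first (by
      rw [hμ0]
      exact Int.add_one_le_iff.1 ((Int.le_ediv_iff_mul_le hu0).2 (by push_cast; linarith)))
    rw [this, hμ0]
    simp
  · intro hlt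
    have hX : setX a b c r = {z : ℤ | ∃ i : ℕ, i ≤ μ ∧ z = x i} := by
      ext z
      rw [H.mem_setX F]
      constructor
      · rintro ⟨i, hi, hiμ, rfl⟩
        lift i to ℕ using hi
        exact ⟨i, by omega, (hxs i).symm⟩
      · rintro ⟨i, hi, rfl⟩
        exact ⟨i, by positivity, by omega, hxs i⟩
    have least : ∀ m : ℕ, m ≤ μ → (IsLeast (setX a b c r) (x m) ↔
        ∀ i, 0 ≤ i → i < (μ : ℤ) + 1 → seqX r u m ≤ seqX r u i) := by
      intro m hm
      constructor
      · intro hl i hi hiμ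
        rw [← hxs]
        exact hl.2 ((H.mem_setX F).2 ⟨i, hi, hiμ, rfl⟩)
      · intro hmin
        refine ⟨(H.mem_setX F).2 ⟨m, by positivity, by omega, hxs m⟩, ?_⟩
        intro z hz
        obtain ⟨i, hi, hiμ, rfl⟩ := (H.mem_setX F).1 hz
        rw [hxs]
        exact hmin i hi hiμ
    have hμ1 : (1 : ℤ) ≤ r / u := (Int.le_ediv_iff_mul_le hu0).2 (by omega)
    have pos_of_min : ∀ m : ℕ,
        (∀ i, 0 ≤ i → i < (μ : ℤ) + 1 → seqX r u m ≤ seqX r u i) → 1 ≤ m := by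
      intro m hmin
      by_contra! hm0
      obtain rfl : m = 0 := by omega
      have := hmin 1 (by omega) (by omega)
      rw [H.seqX_one, Nat.cast_zero, LatticeBasis.seqX_zero] at this
      linarith
    have ne_of_min : ∀ m : ℕ, m ≤ μ →
        (∀ i, 0 ≤ i → i < (μ : ℤ) + 1 → seqX r u m ≤ seqX r u i) → seqX r u m < seqX r u μ := by
      intro m hm hmin
      -- With K = ⌊r/u⌋ ≤ μ, x_m ≤ x_K = r - uK < u < x_N + u = x_μ; if u ∣ r, then x_K = x_0, a
      -- repetition.
      have h1 := H.seqX_pos ((μ : ℤ) + 1)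
      have h2 : u * (r / u) ≤ r := Int.mul_ediv_self_le hu0.ne'
      have h3 : r < u * (r / u) + u := Int.lt_mul_ediv_self_add hu0
      have h4 := hmin (r / u) (by omega) (by omega)
      rcases h2.lt_or_eq with h2 | h2
      · have h5 : seqX r u (r / u) = r - u * (r / u) := by
          rw [seqX, small _ (by omega) h2]; ring
        linarith
      · exfalso
        refine H.seqX_ne_of_le F le_rfl (by omega : 0 < r / u) (by omega) ?_
        simp only [seqX, h2, Int.ediv_self hr0.ne', mul_zero, Int.zero_ediv]
        ring
    have greatest : ∀ m : ℕ, m ≤ μ →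
        (∀ i, 0 ≤ i → i < (μ : ℤ) + 1 → seqX r u m ≤ seqX r u i) →
        IsGreatest {j : ℕ | j ≤ μ ∧ x j + x m ∈ setX a b c r} (μ - m) := by
      intro m hm hmin
      constructor
      · refine ⟨by omega, (H.mem_setX F).2 ⟨μ, by positivity, by omega, ?_⟩⟩
        have := (H.seq_sub (q := q) (h := h) (ne_of_min m hm hmin)).1
        rw [hxs, hxs, Nat.cast_sub hm, this]
        ring
      · rintro j ⟨hj, hjX⟩
        obtain ⟨i, hi, hiμ, hij⟩ := (H.mem_setX F).1 hjX
        rw [hxs, hxs] at hij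
        have := H.add_lt_of_mem F hi hiμ (j := j) (m := m) (by positivity) (by omega)
          (by positivity) (by omega) hij
        omega
    refine ⟨hX, ⟨m₀, μ - m₀, hm₀, (least m₀ hm₀).2 hmin₀, greatest m₀ hm₀ hmin₀⟩, ?_⟩
    intro m w hm hl hw
    have hmin := (least m hm).1 hl
    have hm1 := pos_of_min m hmin
    obtain rfl : w = μ - m := hw.unique (greatest m hm hmin)
    refine ⟨hm1, ?_⟩
    have hpred := H.pred_of_min (hmin ((m : ℤ) - 1) (by omega) (by omega))
    have hsub := (H.seq_sub (q := q) (h := h) (ne_of_min m hm hmin)).2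
    rw [frob m hm hmin, ← max_add_add_right]
    simp only [hxs, hys, Nat.cast_sub hm, Nat.cast_sub hm1, Nat.cast_one, hsub]
    congr 1
    · rw [hh]; ring
    · rw [hpred, hh]; ring
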